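/- Let $\ell\ge 0$ and $n>2\ell$ be integers. Identify $n$-bit strings with elements of $\mathrm{GF}(2^n)=\mathrm{GF}(2)[X]/(p)$ in the polynomial representation, where $p$ is any irreducible polynomial of degree $n$; write $k\cdot r$ for the product of two strings in this field, and $v \bmod 2^\ell$ for the $\ell$ least significant bits of an $n$-bit string $v$ (the coefficients of $X^0,\dots,X^{\ell-1}$). Consider the following protocol. Alice holds an $\ell$-bit message $a$ (register $A$), and Alice and Bob share an $n$-bit key $k$ (register $K$). Alice chooses $r\in\{0,1\}^n$ uniformly at random, independently of everything else, computes $c=a\oplus[(k\cdot r)\bmod 2^\ell]$ and broadcasts $(c,r)$, which is placed in the register $C$ that is leaked to Eve; Bob puts $c\oplus[(k\cdot r)\bmod 2^\ell]$ into his register $B$; then $k$ is discarded. The previous contents of $B$ and $C$ are overwritten. Let $\Phi_{KABC\to ABC}$ be the resulting map. Let $D$ be a finite classical register of secret data and $E$ a finite-dimensional quantum register of Eve. The admissible inputs are the states $\rho_{KABCDE}$ that are classical on $K,A,B,C,D$ and quantum on $E$ and for which the key is uniform and independent of everything except possibly the message, i.e. $\rho_{KBCDE}=U_K\otimes\rho_{BCDE}$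 with $U_K$ the completely mixed state; $A$ may be correlated arbitrarily with $K$ and with the other registers. The ideal private channel is $$\Phi^{IPC}_{AB}(\rho)=\sum_{x,y}\big(|x\rangle\langle x|_A\otimes|x\rangle\langle y|_B\big)\,\rho\,\big(|x\rangle\langle x|_A\otimes|y\rangle\langle x|_B\big).$$ Then the protocol implements an $\epsilon$-insider-proof private channel from $A$ to $B$ with $\epsilon=\sqrt{2^{2\ell-n}}$. That is, $\Phi$ is a quantum channel (completely positive and trace preserving), and for every finite-dimensional $E$ there is a quantum channel $\Psi_{CE}$, acting on Eve's registers $C$ and $E$ alone and depending neither on $D$ nor on the state, such that for every $D$ and every admissible $\rho_{KABCDE}$ $$\big\|(\Phi^{IPC}_{AB}\otimes I_D\otimes\Psi_{CE})(\rho_{ABCDE})-(\Phi_{KABC\to ABC}\otimes I_{DE})(\rho_{KABCDE})\big\|_1\le\sqrt{2^{2\ell-n}},$$ where $\rho_{ABCDE}=\mathrm{tr}_K\,\rho_{KABCDE}$ and $\|X\|_1=\mathrm{tr}\sqrt{X^\dagger X}$. -/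

import Mathlib

open scoped Kronecker Matrix Polynomial ComplexOrder

namespace InsiderProof

noncomputable section

/-- Operators on the finite-dimensional Hilbert space with orthonormal basis indexed by `ι`.
A joint system of two registers is indexed by the product of the index types. -/
abbrev Op (ι : Type*) := Matrix ι ι ℂ

/-- Quantum states, that is density operators. -/
structure IsState {ι : Type*} [Fintype ι] (ρ : Op ι) : Prop where
  posSemidef : ρ.PosSemidef
  trace_eq_one : ρ.trace = 1

/-- The state `ρ` is classical on the registers that `π` selects: it is block diagonal in the
computational basis of these registers. -/
def IsClassicalOn {ι κ : Type*} (π : ι → κ) (ρ : Op ι) : Prop :=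
  ∀ i j, π i ≠ π j → ρ i j = 0

/-- The trace norm `‖X‖₁ = tr √(Xᴴ X)`, that is the sum of the singular values of `X`. -/
def traceNorm {ι : Type*} [Fintype ι] [DecidableEq ι] (X : Op ι) : ℝ :=
  ∑ i, √((Matrix.isHermitian_conjTranspose_mul_self X).eigenvalues i)

/-- The completely mixed state. -/
def maximallyMixed (ι : Type*) [Fintype ι] [DecidableEq ι] : Op ι :=
  (Fintype.card ι : ℂ)⁻¹ • 1

/-- The partial trace over the first register. -/
def traceFst {α β : Type*} [Fintype α] (X : Op (α × β)) : Op β :=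
  Matrix.of fun s t => ∑ i, X (i, s) (i, t)

/-- The tensor product `Φ ⊗ Ψ` of two superoperators, determined by
`(Φ ⊗ Ψ) (M ⊗ N) = Φ M ⊗ Ψ N`. -/
def tensorMap {α α' β β' : Type*} (Φ : Op α →ₗ[ℂ] Op α') (Ψ : Op β →ₗ[ℂ] Op β') :
    Op (α × β) →ₗ[ℂ] Op (α' × β') where
  toFun X := Matrix.of fun p q =>
    Ψ (Matrix.of fun s t => Φ (Matrix.of fun i j => X (i, s) (j, t)) p.1 q.1) p.2 q.2
  map_add' X Y := by
    have h1 : ∀ s t, Φ (Matrix.of fun i j => (X + Y) (i, s) (j, t)) =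
        Φ (Matrix.of fun i j => X (i, s) (j, t)) + Φ (Matrix.of fun i j => Y (i, s) (j, t)) := by
      intro s t
      rw [← map_add]
      rfl
    simp only [h1]
    ext p q
    exact congrFun (congrFun (map_add Ψ
      (Matrix.of fun s t => Φ (Matrix.of fun i j => X (i, s) (j, t)) p.1 q.1)
      (Matrix.of fun s t => Φ (Matrix.of fun i j => Y (i, s) (j, t)) p.1 q.1)) p.2) q.2
  map_smul' z X := by
    have h1 : ∀ s t, Φ (Matrix.of fun i j => (z • X) (i, s) (j, t)) =
        z • Φ (Matrix.of fun i j => X (i, s) (j, t)) := by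
      intro s t
      rw [← map_smul]
      rfl
    simp only [h1]
    ext p q
    exact congrFun (congrFun (map_smul Ψ z
      (Matrix.of fun s t => Φ (Matrix.of fun i j => X (i, s) (j, t)) p.1 q.1)) p.2) q.2

/-- Quantum channels: trace-preserving, completely positive linear maps. -/
structure IsChannel {α β : Type*} [Fintype α] [Fintype β] (Φ : Op α →ₗ[ℂ] Op β) : Prop where
  trace_map : ∀ X, (Φ X).trace = X.trace
  completelyPositive : ∀ (m : ℕ) (X : Op (Fin m × α)), X.PosSemidef →
    (tensorMap (LinearMap.id : Op (Fin m) →ₗ[ℂ] Op (Fin m)) Φ X).PosSemidef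

/-- The superoperator `X ↦ L X Lᴴ`. -/
def conjMap {α β : Type*} [Fintype α] (L : Matrix β α ℂ) : Op α →ₗ[ℂ] Op β where
  toFun X := L * X * Lᴴ
  map_add' X Y := by rw [Matrix.mul_add, Matrix.add_mul]
  map_smul' z X := by rw [Matrix.mul_smul, Matrix.smul_mul, RingHom.id_apply]

/-- The ideal private channel from `A` to `B`,
`ρ ↦ ∑ x y, (|x⟩⟨x| ⊗ |x⟩⟨y|) ρ (|x⟩⟨x| ⊗ |y⟩⟨x|)`. -/
def idealPrivateChannel (A : Type*) [Fintype A] [DecidableEq A] :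
    Op (A × A) →ₗ[ℂ] Op (A × A) :=
  ∑ x : A, ∑ y : A, conjMap ((Matrix.single x x (1 : ℂ)) ⊗ₖ (Matrix.single x y (1 : ℂ)))

/-- The channel that evaluates the function `f` on classical data:
`ρ ↦ ∑ i, |f i⟩⟨i| ρ |i⟩⟨f i|`. -/
def evalChannel {α β : Type*} [Fintype α] [DecidableEq α] [DecidableEq β] (f : α → β) :
    Op α →ₗ[ℂ] Op β :=
  ∑ i : α, conjMap (Matrix.single (f i) i (1 : ℂ))

section Security

variable {K A C D E : Type*}

/-- The channel `Φ_{KABC → ABC} ⊗ I_{DE}`. The key register `K` is consumed. -/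
def realOutput (Φ : Op (K × A × A × C) →ₗ[ℂ] Op (A × A × C)) (ρ : Op (K × A × A × C × D × E)) :
    Op (A × A × C × D × E) :=
  (tensorMap Φ (LinearMap.id : Op (D × E) →ₗ[ℂ] Op (D × E))
    (ρ.submatrix (fun ((k, a, b, c), (d, e)) => (k, a, b, c, d, e))
      (fun ((k, a, b, c), (d, e)) => (k, a, b, c, d, e)))).submatrix
    (fun (a, b, c, d, e) => ((a, b, c), (d, e))) (fun (a, b, c, d, e) => ((a, b, c), (d, e)))

/-- The channel `Φ^{IPC}_{AB} ⊗ I_D ⊗ Ψ_{CE}`. -/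
def idealOutput [Fintype A] [DecidableEq A] (Ψ : Op (C × E) →ₗ[ℂ] Op (C × E))
    (ρ : Op (A × A × C × D × E)) : Op (A × A × C × D × E) :=
  (tensorMap (idealPrivateChannel A) (tensorMap (LinearMap.id : Op D →ₗ[ℂ] Op D) Ψ)
    (ρ.submatrix (fun ((a, b), (d, (c, e))) => (a, b, c, d, e))
      (fun ((a, b), (d, (c, e))) => (a, b, c, d, e)))).submatrix
    (fun (a, b, c, d, e) => ((a, b), (d, (c, e)))) (fun (a, b, c, d, e) => ((a, b), (d, (c, e))))

/-- The admissible inputs: states `ρ_{KABCDE}` that are classical on `K`, `A`, `B`, `C`, `D` and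
quantum on `E`, with a uniform key that is independent of everything but the message, that is
`ρ_{KBCDE} = U_K ⊗ ρ_{BCDE}`. The joint law of `K` and `A` is not restricted further. -/
structure IsAdmissible [Fintype K] [DecidableEq K] [Fintype A] [Fintype C] [Fintype D] [Fintype E]
    (ρ : Op (K × A × A × C × D × E)) : Prop where
  isState : IsState ρ
  classical : IsClassicalOn (fun (k, a, b, c, d, _) => (k, a, b, c, d)) ρ
  key : traceFst (ρ.submatrix (fun (a, k, s) => (k, a, s)) (fun (a, k, s) => (k, a, s))) =
    maximallyMixed K ⊗ₖ traceFst (traceFst ρ)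

end Security

/-- `Φ`, which acts on the message register `A`, Bob's register `B` (of the same type as `A`), the
register `C` of all data leaked to Eve, and consumes a shared key `K`, is an `ε`-insider-proof
private channel from `A` to `B`. Eve holds a quantum system `E` of any finite dimension, and the
simulator `Ψ` acts on `C` and `E` only; it depends neither on the state nor on the register `D`
of secret data. -/
def IsInsiderProofPrivateChannel {K A C : Type*} [Fintype K] [DecidableEq K] [Fintype A]
    [DecidableEq A] [Fintype C] [DecidableEq C]
    (Φ : Op (K × A × A × C) →ₗ[ℂ] Op (A × A × C)) (ε : ℝ) : Prop :=
  IsChannel Φ ∧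
  ∀ (E : Type) [Fintype E] [DecidableEq E],
    ∃ Ψ : Op (C × E) →ₗ[ℂ] Op (C × E), IsChannel Ψ ∧
      ∀ (D : Type) [Fintype D] [DecidableEq D] (ρ : Op (K × A × A × C × D × E)),
        IsAdmissible ρ →
          traceNorm (idealOutput Ψ (traceFst ρ) - realOutput Φ ρ) ≤ ε

/-- Strings of `n` bits; bitwise exclusive or is addition. Index `0` is the least significant
bit. -/
abbrev Bits (n : ℕ) := Fin n → ZMod 2

instance instDecidableEqBits (n : ℕ) : DecidableEq (Bits n) :=
  fun v w => Fintype.decidablePiFintype v w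

/-- The polynomial over `GF(2)` whose coefficients are the given bits. -/
def toPoly {n : ℕ} (v : Bits n) : (ZMod 2)[X] := ∑ i : Fin n, Polynomial.monomial (i : ℕ) (v i)

/-- The product of two `n`-bit strings as elements of `GF(2^n) = GF(2)[X] / (p)`, in the
polynomial representation, for `p` irreducible of degree `n`. -/
def gfMul {n : ℕ} (p : (ZMod 2)[X]) (v w : Bits n) : Bits n :=
  fun i => ((toPoly v * toPoly w) %ₘ p).coeff i

/-- Reduction modulo `2 ^ ℓ`: the `ℓ` least significant bits of an `n`-bit string. -/
def lowBits {n : ℕ} (ℓ : ℕ) (h : ℓ ≤ n) (v : Bits n) : Bits ℓ :=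
  fun i => v (Fin.castLE h i)

/-- The classical computation of the protocol when Alice's random string is `r`: from key `k` and
message `a`, Alice broadcasts `(c, r)`, and Bob computes his output from `c`, `r` and `k`. The
previous contents of Bob's register and of the public register are overwritten. -/
def protocolRun {n : ℕ} (ℓ : ℕ) (h : ℓ ≤ n) (p : (ZMod 2)[X]) (r : Bits n) :
    Bits n × Bits ℓ × Bits ℓ × (Bits ℓ × Bits n) → Bits ℓ × Bits ℓ × (Bits ℓ × Bits n) :=
  fun (k, a, _, _) =>
    let c : Bits ℓ := a + lowBits ℓ h (gfMul p k r)
    let b : Bits ℓ := c + lowBits ℓ h (gfMul p k r)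
    (a, b, (c, r))

/-- The channel that the protocol implements: `r` is chosen uniformly at random. -/
def protocol {n : ℕ} (ℓ : ℕ) (h : ℓ ≤ n) (p : (ZMod 2)[X]) :
    Op (Bits n × Bits ℓ × Bits ℓ × (Bits ℓ × Bits n)) →ₗ[ℂ]
      Op (Bits ℓ × Bits ℓ × (Bits ℓ × Bits n)) :=
  (Fintype.card (Bits n) : ℂ)⁻¹ • ∑ r : Bits n, evalChannel (protocolRun ℓ h p r)

end

end InsiderProof

/-!
The real and the ideal output differ by an operator that is block diagonal in the registers `A`,
`B`, `C`, whose block at message `a` and public data `(c, r)` is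
`2⁻ⁿ ∑ k, (2^(-ℓ) - [a + h_r k = c]) • τ k a`. Here `h_r k = (k · r) mod 2^ℓ`, and `τ k a` is the
unnormalised state of `D E` for key `k` and message `a`; the simulator replaces `C` by fresh
uniform bits. The claim is therefore a privacy amplification statement, where the message may
depend on the key.

Two facts drive the bound. The family `h_r` is exactly universal, since for `k ≠ k'` the map
`r ↦ ((k - k') · r) mod 2^ℓ` is linear and onto (`card_collision`), so the weights
`2^(-ℓ) - [a + h_r k = c]`, read for each key `k` as a vector indexed by `(c, r)`, are orthogonal
for distinct keys (`hashWeight_gram`).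
And `τ k a ≤ 2⁻ⁿ σ` for every `a`, with `σ` the state of `D E`, because the key is uniform and
independent of `D E` once the message is summed out (`IsAdmissible.condState_le`).

The trace norm is written as the trace against one contraction `U`
(`exists_contraction_trace_mul`), whose blocks `U a j`, `j = (c, r)`, are again contractions. With
`V a k` the combination of the `U a j` by the weights, each term is bounded by
`2 Re tr (V τ) ≤ t tr τ + t⁻¹ tr (Vᴴ τ V)`, then `τ` is replaced by `2⁻ⁿ σ` in the last trace, and
orthogonality of the weights controls the sum over `k` (`sum_trace_mul_hash_le`). The choice
`t = √(2^(2ℓ-n))` balances the two terms: one factor `2^ℓ` under the root comes from the values of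
`c`, the other from the sum over the messages `a`. Unlike in the usual leftover hash lemma, no
inverse root of `σ` appears. That `D` is classical plays no role.
-/

namespace InsiderProof

/-! ### Trace norm and hashing against contractions -/

open scoped MatrixOrder in
theorem exists_eq_conjTranspose_mul_self {ι : Type*} [Fintype ι] {M : Op ι}
    (hM : M.PosSemidef) : ∃ S : Op ι, M = Sᴴ * S := by
  classical
  exact CStarAlgebra.nonneg_iff_eq_star_mul_self.1 hM.nonneg

/-- The trace norm of `X` is attained as `tr (U X)` at some contraction `U`. -/
theorem exists_contraction_trace_mul {ι : Type*} [Fintype ι] [DecidableEq ι] (X : Op ι) :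
    ∃ U : Op ι, (1 - U * Uᴴ).PosSemidef ∧ (traceNorm X : ℂ) = (U * X).trace := by
  have hH := Matrix.isHermitian_conjTranspose_mul_self X
  have hnn : ∀ i, 0 ≤ hH.eigenvalues i :=
    (Matrix.posSemidef_conjTranspose_mul_self X).eigenvalues_nonneg
  set Q : Op ι := (hH.eigenvectorUnitary : Matrix ι ι ℂ) with hQ
  have hQ1 : Qᴴ * Q = 1 := Unitary.coe_star_mul_self hH.eigenvectorUnitary
  have hQ2 : Q * Qᴴ = 1 := Unitary.coe_mul_star_self hH.eigenvectorUnitary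
  have hspec : Xᴴ * X = Q * Matrix.diagonal (fun i => (hH.eigenvalues i : ℂ)) * Qᴴ := by
    have := hH.spectral_theorem
    rw [Unitary.conjStarAlgAut_apply] at this
    exact this
  have hmid : Qᴴ * (Xᴴ * X) * Q = Matrix.diagonal (fun i => (hH.eigenvalues i : ℂ)) := by
    calc Qᴴ * (Xᴴ * X) * Q
        = Qᴴ * (Q * Matrix.diagonal (fun i => (hH.eigenvalues i : ℂ)) * Qᴴ) * Q :=
          congrArg (fun M => Qᴴ * M * Q) hspec
      _ = (Qᴴ * Q) * Matrix.diagonal (fun i => (hH.eigenvalues i : ℂ)) * (Qᴴ * Q) := by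
          simp only [Matrix.mul_assoc]
      _ = _ := by rw [hQ1, Matrix.one_mul, Matrix.mul_one]
  -- the pseudo-inverse of `√(Xᴴ X)`: on the kernel, `(√0)⁻¹ = 0` is the value that is needed
  set s : ι → ℂ := fun i => (((√(hH.eigenvalues i))⁻¹ : ℝ) : ℂ) with hs
  have hsH : (Matrix.diagonal s)ᴴ = Matrix.diagonal s := by
    rw [Matrix.diagonal_conjTranspose]
    congr 1
    funext i
    simp [hs]
  refine ⟨Q * Matrix.diagonal s * Qᴴ * Xᴴ, ?_, ?_⟩
  · have h1 : (Q * Matrix.diagonal s * Qᴴ * Xᴴ) * (Q * Matrix.diagonal s * Qᴴ * Xᴴ)ᴴ =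
        Q * (Matrix.diagonal s * (Qᴴ * (Xᴴ * X) * Q) * Matrix.diagonal s) * Qᴴ := by
      simp only [Matrix.conjTranspose_mul, Matrix.conjTranspose_conjTranspose, hsH,
        Matrix.mul_assoc]
    have h2 : (1 : Op ι) - (Q * Matrix.diagonal s * Qᴴ * Xᴴ) *
        (Q * Matrix.diagonal s * Qᴴ * Xᴴ)ᴴ =
        Q * Matrix.diagonal (fun i => 1 - s i * hH.eigenvalues i * s i) * Qᴴ := by
      rw [h1, hmid, Matrix.diagonal_mul_diagonal, Matrix.diagonal_mul_diagonal,
        ← Matrix.diagonal_sub, Matrix.mul_sub, Matrix.sub_mul, Matrix.diagonal_one,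
        Matrix.mul_one, hQ2]
    rw [h2]
    refine Matrix.PosSemidef.mul_mul_conjTranspose_same (Matrix.PosSemidef.diagonal ?_) Q
    intro i
    have h3 : (√(hH.eigenvalues i))⁻¹ * hH.eigenvalues i * (√(hH.eigenvalues i))⁻¹ ≤ 1 := by
      rcases (hnn i).eq_or_lt with h0 | h0
      · simp [← h0]
      · have : 0 < √(hH.eigenvalues i) := Real.sqrt_pos.2 h0
        have h4 := Real.mul_self_sqrt (hnn i)
        field_simp
        nlinarith
    have h5 : (0 : ℝ) ≤ 1 - (√(hH.eigenvalues i))⁻¹ * hH.eigenvalues i *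
        (√(hH.eigenvalues i))⁻¹ := by linarith
    have h6 := Complex.zero_le_real.2 h5
    simpa [hs] using h6
  · have h1 : (Q * Matrix.diagonal s * Qᴴ * Xᴴ * X).trace =
        (Matrix.diagonal s * (Qᴴ * (Xᴴ * X) * Q)).trace := by
      rw [show Q * Matrix.diagonal s * Qᴴ * Xᴴ * X =
        Q * (Matrix.diagonal s * (Qᴴ * (Xᴴ * X))) by simp only [Matrix.mul_assoc],
        Matrix.trace_mul_comm]
      simp only [Matrix.mul_assoc]
    rw [h1, hmid, Matrix.diagonal_mul_diagonal, Matrix.trace_diagonal, traceNorm,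
      Complex.ofReal_sum]
    refine Finset.sum_congr rfl fun i _ => ?_
    rw [hs, ← Complex.ofReal_mul]
    congr 1
    rcases (hnn i).eq_or_lt with h0 | h0
    · simp [← h0]
    · have : 0 < √(hH.eigenvalues i) := Real.sqrt_pos.2 h0
      have h4 := Real.mul_self_sqrt (hnn i)
      field_simp
      nlinarith

theorem trace_re_nonneg {ι : Type*} [Fintype ι] {M : Op ι} (hM : M.PosSemidef) :
    0 ≤ M.trace.re :=
  (Complex.le_def.1 hM.trace_nonneg).1

/-- The diagonal blocks of a contraction are contractions. -/
theorem contraction_submatrix {ι κ : Type*} [Fintype ι] [DecidableEq ι] [Fintype κ]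
    [DecidableEq κ] {U : Op ι} (hU : (1 - U * Uᴴ).PosSemidef) {f : κ → ι}
    (hf : Function.Injective f) :
    (1 - U.submatrix f f * (U.submatrix f f)ᴴ).PosSemidef := by
  classical
  set Y : Matrix κ ι ℂ := Matrix.of fun x q => if q ∈ Set.range f then 0 else U (f x) q with hY
  have h : 1 - U.submatrix f f * (U.submatrix f f)ᴴ =
      (1 - U * Uᴴ).submatrix f f + Y * Yᴴ := by
    ext x y
    have h1 : (1 : Op ι) (f x) (f y) = (1 : Op κ) x y := by
      simp [Matrix.one_apply, hf.eq_iff]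
    have h2 : ∑ z, U (f x) (f z) * star (U (f y) (f z)) =
        ∑ q, if q ∈ Set.range f then U (f x) q * star (U (f y) q) else 0 := by
      rw [← Finset.sum_filter, ← Finset.sum_image (f := fun q => U (f x) q * star (U (f y) q))
        (g := f) (fun _ _ _ _ h => hf h)]
      congr 1
      ext q
      simp
    have h3 : ∑ q, U (f x) q * star (U (f y) q) =
        (∑ q, if q ∈ Set.range f then U (f x) q * star (U (f y) q) else 0) +
          ∑ q, Y x q * star (Y y q) := by
      rw [← Finset.sum_add_distrib]
      refine Finset.sum_congr rfl fun q _ => ?_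
      by_cases hq : q ∈ Set.range f
      · simp only [hY, Matrix.of_apply, if_pos hq, zero_mul, add_zero]
      · simp only [hY, Matrix.of_apply, if_neg hq, zero_add]
    simp only [Matrix.sub_apply, Matrix.add_apply, Matrix.submatrix_apply, Matrix.mul_apply,
      Matrix.conjTranspose_apply]
    rw [h1, h2, h3]
    ring
  rw [h]
  exact (hU.submatrix f).add (Matrix.posSemidef_self_mul_conjTranspose Y)

theorem trace_conj_le_of_contraction {ι : Type*} [Fintype ι] [DecidableEq ι] {σ U : Op ι}
    (hσ : σ.PosSemidef) (hU : (1 - U * Uᴴ).PosSemidef) :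
    (Uᴴ * σ * U).trace.re ≤ σ.trace.re := by
  obtain ⟨S, rfl⟩ := exists_eq_conjTranspose_mul_self hσ
  have h := trace_re_nonneg (hU.mul_mul_conjTranspose_same S)
  have h1 : (S * (1 - U * Uᴴ) * Sᴴ).trace =
      (Sᴴ * S).trace - (Uᴴ * (Sᴴ * S) * U).trace := by
    rw [Matrix.mul_sub, Matrix.sub_mul, Matrix.trace_sub, Matrix.mul_one,
      Matrix.trace_mul_comm S Sᴴ]
    congr 1
    rw [show Uᴴ * (Sᴴ * S) * U = (Uᴴ * Sᴴ) * (S * U) by simp only [Matrix.mul_assoc],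
      Matrix.trace_mul_comm (Uᴴ * Sᴴ)]
    simp only [Matrix.mul_assoc]
  rw [h1, Complex.sub_re] at h
  linarith

theorem trace_conj_mono {ι : Type*} [Fintype ι] {τ σ : Op ι} (h : (σ - τ).PosSemidef)
    (V : Op ι) : (Vᴴ * τ * V).trace.re ≤ (Vᴴ * σ * V).trace.re := by
  have h1 := trace_re_nonneg (h.conjTranspose_mul_mul_same V)
  rw [Matrix.mul_sub, Matrix.sub_mul, Matrix.trace_sub, Complex.sub_re] at h1
  linarith

/-- The weighted form of the Cauchy–Schwarz inequality for the semi-inner product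
`⟨V, W⟩ = tr (Vᴴ τ W)`, applied to `V` and the identity. -/
theorem two_mul_trace_mul_le {ι : Type*} [Fintype ι] [DecidableEq ι] {τ : Op ι}
    (hτ : τ.PosSemidef) (V : Op ι) {t : ℝ} (ht : 0 < t) :
    2 * (V * τ).trace.re ≤ t * τ.trace.re + t⁻¹ * (Vᴴ * τ * V).trace.re := by
  have h := trace_re_nonneg (hτ.conjTranspose_mul_mul_same ((t : ℂ) • (1 : Op ι) - V))
  have hconj : (Vᴴ * τ).trace = star (V * τ).trace := by
    rw [← Matrix.trace_conjTranspose, Matrix.conjTranspose_mul, hτ.isHermitian.eq,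
      Matrix.trace_mul_comm]
  have h1 : (((t : ℂ) • (1 : Op ι) - V)ᴴ * τ * ((t : ℂ) • (1 : Op ι) - V)).trace =
      (t : ℂ) * t * τ.trace - t * (V * τ).trace - t * star (V * τ).trace +
        (Vᴴ * τ * V).trace := by
    rw [← hconj, Matrix.trace_mul_comm V τ]
    simp only [Matrix.conjTranspose_sub, Matrix.conjTranspose_smul, Matrix.conjTranspose_one,
      Matrix.sub_mul, Matrix.mul_sub, Matrix.smul_mul, Matrix.mul_smul, Matrix.one_mul,
      Matrix.mul_one, Matrix.trace_sub, Matrix.trace_smul, smul_eq_mul, Complex.star_def,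
      Complex.conj_ofReal]
    ring
  rw [h1] at h
  simp only [Complex.add_re, Complex.sub_re, Complex.mul_re, Complex.ofReal_re,
    Complex.ofReal_im, Complex.mul_im, Complex.star_def, Complex.conj_re, zero_mul, mul_zero,
    sub_zero, add_zero] at h
  have h2 : t⁻¹ * (2 * t * (V * τ).trace.re) ≤
      t⁻¹ * (t * t * τ.trace.re + (Vᴴ * τ * V).trace.re) :=
    mul_le_mul_of_nonneg_left (by linarith) (inv_nonneg.2 ht.le)
  have h3 : t⁻¹ * t = 1 := inv_mul_cancel₀ ht.ne'
  calc 2 * (V * τ).trace.re = (t⁻¹ * t) * (2 * (V * τ).trace.re) := by rw [h3, one_mul]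
    _ = t⁻¹ * (2 * t * (V * τ).trace.re) := by ring
    _ ≤ _ := h2
    _ = (t⁻¹ * t) * (t * τ.trace.re) + t⁻¹ * (Vᴴ * τ * V).trace.re := by ring
    _ = _ := by rw [h3, one_mul]

/-- If the columns of `w` are orthogonal with squared norm at most `N`, then the transpose of `w`
has squared operator norm at most `N`. -/
theorem sum_normSq_le_of_gram {J K : Type*} [Fintype J] [Fintype K] [DecidableEq K]
    {w : J → K → ℝ} {N c : ℝ} (hN : 0 < N) (hc : c ≤ N)
    (hw : ∀ k k', ∑ j, w j k * w j k' = if k = k' then c else 0) (u : J → ℂ) :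
    ∑ k, Complex.normSq (∑ j, (w j k : ℂ) * u j) ≤ N * ∑ j, Complex.normSq (u j) := by
  have real_case : ∀ x : J → ℝ, ∑ k, (∑ j, w j k * x j) ^ 2 ≤ N * ∑ j, x j ^ 2 := by
    intro x
    set v : K → ℝ := fun k => ∑ j, w j k * x j with hv
    -- compare `x` with `N⁻¹ • w v`, which is its projection onto the columns of `w` when `c = N`
    have h0 : 0 ≤ ∑ j, (N * x j - ∑ k, w j k * v k) ^ 2 :=
      Finset.sum_nonneg fun _ _ => sq_nonneg _
    have h1 : ∑ j, x j * ∑ k, w j k * v k = ∑ k, v k ^ 2 := by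
      simp only [Finset.mul_sum]
      rw [Finset.sum_comm]
      refine Finset.sum_congr rfl fun k _ => ?_
      rw [sq]
      nth_rewrite 2 [hv]
      simp only
      rw [Finset.sum_mul]
      exact Finset.sum_congr rfl fun j _ => by ring
    have h2 : ∑ j, (∑ k, w j k * v k) ^ 2 = c * ∑ k, v k ^ 2 := by
      calc ∑ j, (∑ k, w j k * v k) ^ 2
          = ∑ j, ∑ k, ∑ k', (w j k * w j k') * (v k * v k') := by
            refine Finset.sum_congr rfl fun j _ => ?_
            rw [sq, Finset.sum_mul_sum]
            exact Finset.sum_congr rfl fun k _ => Finset.sum_congr rfl fun k' _ => by ring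
        _ = ∑ k, ∑ k', (∑ j, w j k * w j k') * (v k * v k') := by
            rw [Finset.sum_comm]
            refine Finset.sum_congr rfl fun k _ => ?_
            rw [Finset.sum_comm]
            exact Finset.sum_congr rfl fun k' _ => (Finset.sum_mul ..).symm
        _ = c * ∑ k, v k ^ 2 := by
            simp only [hw, ite_mul, zero_mul, Finset.sum_ite_eq, Finset.mem_univ, if_true]
            rw [Finset.mul_sum]
            exact Finset.sum_congr rfl fun k _ => by ring
    have h3 : ∑ j, (N * x j - ∑ k, w j k * v k) ^ 2 =
        N ^ 2 * ∑ j, x j ^ 2 - 2 * N * ∑ k, v k ^ 2 + c * ∑ k, v k ^ 2 := by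
      rw [← h2, ← h1, Finset.mul_sum, Finset.mul_sum, ← Finset.sum_sub_distrib,
        ← Finset.sum_add_distrib]
      exact Finset.sum_congr rfl fun j _ => by ring
    have h4 : 0 ≤ ∑ k, v k ^ 2 := Finset.sum_nonneg fun _ _ => sq_nonneg _
    have h5 : N * ∑ k, v k ^ 2 ≤ N * (N * ∑ j, x j ^ 2) := by nlinarith
    exact le_of_mul_le_mul_left h5 hN
  have hre := real_case fun j => (u j).re
  have him := real_case fun j => (u j).im
  have e1 : ∀ k, Complex.normSq (∑ j, (w j k : ℂ) * u j) =
      (∑ j, w j k * (u j).re) ^ 2 + (∑ j, w j k * (u j).im) ^ 2 := by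
    intro k
    rw [Complex.normSq_apply, Complex.re_sum, Complex.im_sum]
    simp only [Complex.re_ofReal_mul, Complex.im_ofReal_mul]
    ring
  simp only [e1, Finset.sum_add_distrib, Complex.normSq_apply, ← sq, mul_add]
  linarith

theorem trace_conjTranspose_mul_self_re {ι κ : Type*} [Fintype ι] [Fintype κ] (M : Matrix κ ι ℂ) :
    (Mᴴ * M).trace.re = ∑ x, ∑ y, Complex.normSq (M y x) := by
  simp only [Matrix.trace, Matrix.diag_apply, Matrix.mul_apply, Matrix.conjTranspose_apply,
    Complex.re_sum]
  refine Finset.sum_congr rfl fun x _ => Finset.sum_congr rfl fun y _ => ?_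
  rw [Complex.star_def, ← Complex.normSq_eq_conj_mul_self, Complex.ofReal_re]

/-- Operator version of `sum_normSq_le_of_gram`, for the quadratic form `V ↦ tr (Vᴴ σ V)`. -/
theorem sum_trace_conj_le_of_gram {J K ι : Type*} [Fintype J] [Fintype K] [DecidableEq K]
    [Fintype ι] {w : J → K → ℝ} {N c : ℝ} (hN : 0 < N) (hc : c ≤ N)
    (hw : ∀ k k', ∑ j, w j k * w j k' = if k = k' then c else 0) {σ : Op ι}
    (hσ : σ.PosSemidef) (U : J → Op ι) :
    ∑ k, ((∑ j, (w j k : ℂ) • U j)ᴴ * σ * ∑ j, (w j k : ℂ) • U j).trace.re ≤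
      N * ∑ j, ((U j)ᴴ * σ * U j).trace.re := by
  obtain ⟨S, rfl⟩ := exists_eq_conjTranspose_mul_self hσ
  have e : ∀ V : Op ι, (Vᴴ * (Sᴴ * S) * V).trace.re =
      ∑ x, ∑ y, Complex.normSq ((S * V) y x) := by
    intro V
    rw [← trace_conjTranspose_mul_self_re, Matrix.conjTranspose_mul]
    simp only [Matrix.mul_assoc]
  have e2 : ∀ k x y, (S * ∑ j, (w j k : ℂ) • U j) y x =
      ∑ j, (w j k : ℂ) * (S * U j) y x := by
    intro k x y
    rw [Matrix.mul_sum, Matrix.sum_apply]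
    refine Finset.sum_congr rfl fun j _ => ?_
    rw [Matrix.mul_smul, Matrix.smul_apply, smul_eq_mul]
  simp only [e, e2]
  calc ∑ k, ∑ x, ∑ y, Complex.normSq (∑ j, (w j k : ℂ) * (S * U j) y x)
      = ∑ x, ∑ y, ∑ k, Complex.normSq (∑ j, (w j k : ℂ) * (S * U j) y x) := by
        rw [Finset.sum_comm]
        exact Finset.sum_congr rfl fun x _ => Finset.sum_comm
    _ ≤ ∑ x, ∑ y, N * ∑ j, Complex.normSq ((S * U j) y x) :=
        Finset.sum_le_sum fun x _ => Finset.sum_le_sum fun y _ =>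
          sum_normSq_le_of_gram hN hc hw fun j => (S * U j) y x
    _ = N * ∑ j, ∑ x, ∑ y, Complex.normSq ((S * U j) y x) := by
        simp only [← Finset.mul_sum]
        congr 1
        rw [Finset.sum_comm (s := (Finset.univ : Finset J))]
        exact Finset.sum_congr rfl fun x _ => Finset.sum_comm

/-- The hashing bound, tested against contractions `U a j`: if every `τ k a` is dominated by
`σ / N` and the hash weights `w a` have an orthogonal Gram matrix, then the averages
`N⁻¹ ∑ k, w a j k • τ k a` are small on average over `j`. -/
theorem sum_trace_mul_hash_le {J K A ι : Type*} [Fintype J] [Fintype K] [DecidableEq K]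
    [Fintype A] [Fintype ι] [DecidableEq ι] {w : A → J → K → ℝ} {N c : ℝ} (hN : 0 < N)
    (hc : c ≤ N)
    (hw : ∀ a k k', ∑ j, w a j k * w a j k' = if k = k' then c else 0)
    {σ : Op ι} (hσ : σ.PosSemidef) (hσ1 : σ.trace.re = 1) {τ : K → A → Op ι}
    (hτ : ∀ k a, (τ k a).PosSemidef) (hτ1 : ∑ k, ∑ a, (τ k a).trace.re = 1)
    (hdom : ∀ k a, ((N⁻¹ : ℝ) • σ - τ k a).PosSemidef)
    {U : A → J → Op ι} (hU : ∀ a j, (1 - U a j * (U a j)ᴴ).PosSemidef) {t : ℝ} (ht : 0 < t)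
    (hcard : (Fintype.card A * Fintype.card J : ℝ) ≤ t ^ 2 * N ^ 2) :
    (∑ a, ∑ j, (U a j * ∑ k, ((N⁻¹ * w a j k : ℝ) : ℂ) • τ k a).trace).re ≤ t := by
  set V : A → K → Op ι := fun a k => ∑ j, (w a j k : ℂ) • U a j with hV
  have h1 : (∑ a, ∑ j, (U a j * ∑ k, ((N⁻¹ * w a j k : ℝ) : ℂ) • τ k a).trace) =
      ∑ a, ∑ k, ((((N⁻¹ : ℝ) : ℂ) • V a k) * τ k a).trace := by
    refine Finset.sum_congr rfl fun a _ => ?_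
    simp only [hV, Matrix.mul_sum, Matrix.trace_sum, Matrix.smul_mul, Matrix.sum_mul,
      Matrix.mul_smul, Matrix.trace_smul, Finset.smul_sum, smul_smul]
    rw [Finset.sum_comm]
    push_cast
    rfl
  have h2 : ∀ a k, 2 * ((((N⁻¹ : ℝ) : ℂ) • V a k) * τ k a).trace.re ≤
      t * (τ k a).trace.re + t⁻¹ * (N⁻¹ ^ 3 * ((V a k)ᴴ * σ * V a k).trace.re) := by
    intro a k
    refine (two_mul_trace_mul_le (hτ k a) _ ht).trans ?_
    have h3 := trace_conj_mono (hdom k a) (((N⁻¹ : ℝ) : ℂ) • V a k)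
    have h4 : ((((N⁻¹ : ℝ) : ℂ) • V a k)ᴴ * ((N⁻¹ : ℝ) • σ) *
        (((N⁻¹ : ℝ) : ℂ) • V a k)).trace.re = N⁻¹ ^ 3 * ((V a k)ᴴ * σ * V a k).trace.re := by
      simp only [Matrix.conjTranspose_smul, Matrix.smul_mul, Matrix.mul_smul,
        Matrix.trace_smul, smul_eq_mul, Complex.star_def, Complex.conj_ofReal,
        Complex.re_ofReal_mul, Complex.real_smul]
      ring
    rw [h4] at h3
    have := mul_le_mul_of_nonneg_left h3 (inv_nonneg.2 ht.le)
    linarith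
  have h5 : ∀ a, ∑ k, ((V a k)ᴴ * σ * V a k).trace.re ≤ N * Fintype.card J := by
    intro a
    refine (sum_trace_conj_le_of_gram hN hc (hw a) hσ (U a)).trans ?_
    refine mul_le_mul_of_nonneg_left ?_ hN.le
    calc ∑ j, ((U a j)ᴴ * σ * U a j).trace.re ≤ ∑ j : J, (1 : ℝ) :=
          Finset.sum_le_sum fun j _ => hσ1 ▸ trace_conj_le_of_contraction hσ (hU a j)
      _ = Fintype.card J := by simp
  have h6 : ∑ a, ∑ k, ((V a k)ᴴ * σ * V a k).trace.re ≤ t ^ 2 * N ^ 3 := by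
    calc ∑ a, ∑ k, ((V a k)ᴴ * σ * V a k).trace.re ≤ ∑ a : A, N * Fintype.card J :=
          Finset.sum_le_sum fun a _ => h5 a
      _ = N * (Fintype.card A * Fintype.card J) := by
          rw [Finset.sum_const, Finset.card_univ, nsmul_eq_mul]; ring
      _ ≤ N * (t ^ 2 * N ^ 2) := mul_le_mul_of_nonneg_left hcard hN.le
      _ = t ^ 2 * N ^ 3 := by ring
  have h7 : 2 * (∑ a, ∑ k, ((((N⁻¹ : ℝ) : ℂ) • V a k) * τ k a).trace).re ≤
      t * ∑ k, ∑ a, (τ k a).trace.re +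
        t⁻¹ * (N⁻¹ ^ 3 * ∑ a, ∑ k, ((V a k)ᴴ * σ * V a k).trace.re) := by
    rw [Finset.sum_comm (f := fun k a => (τ k a).trace.re)]
    simp only [Complex.re_sum, Finset.mul_sum, ← Finset.sum_add_distrib]
    exact Finset.sum_le_sum fun a _ => Finset.sum_le_sum fun k _ => h2 a k
  have h8 : t⁻¹ * (N⁻¹ ^ 3 * ∑ a, ∑ k, ((V a k)ᴴ * σ * V a k).trace.re) ≤ t := by
    calc _ ≤ t⁻¹ * (N⁻¹ ^ 3 * (t ^ 2 * N ^ 3)) := by gcongr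
      _ = t := by field_simp
  rw [h1]
  rw [hτ1] at h7
  linarith

/-! ### The hash family `r ↦ (k · r) mod 2 ^ ℓ` -/

theorem coeff_toPoly {n : ℕ} (v : Bits n) (i : Fin n) : (toPoly v).coeff i = v i := by
  simp [toPoly, Polynomial.coeff_monomial, Fin.val_inj]

theorem toPoly_injective {n : ℕ} : Function.Injective (toPoly (n := n)) := fun v w h =>
  funext fun i => by rw [← coeff_toPoly v, ← coeff_toPoly w, h]

theorem degree_toPoly_lt {n : ℕ} (v : Bits n) : (toPoly v).degree < n := by
  refine (Polynomial.degree_sum_le _ _).trans_lt ?_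
  refine (Finset.sup_lt_iff (WithBot.bot_lt_coe n)).2 fun i _ => ?_
  exact (Polynomial.degree_monomial_le _ _).trans_lt (Nat.cast_lt.2 i.2)

theorem toPoly_add {n : ℕ} (v w : Bits n) : toPoly (v + w) = toPoly v + toPoly w := by
  simp [toPoly, Finset.sum_add_distrib]

theorem toPoly_smul {n : ℕ} (z : ZMod 2) (v : Bits n) : toPoly (z • v) = z • toPoly v := by
  simp only [toPoly, Finset.smul_sum, Pi.smul_apply, smul_eq_mul, Polynomial.smul_monomial]

theorem gfMul_comm {n : ℕ} (p : (ZMod 2)[X]) (v w : Bits n) : gfMul p v w = gfMul p w v := by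
  funext i
  rw [gfMul, gfMul, mul_comm]

theorem gfMul_add {n : ℕ} (p : (ZMod 2)[X]) (v w w' : Bits n) :
    gfMul p v (w + w') = gfMul p v w + gfMul p v w' := by
  funext i
  simp [gfMul, toPoly_add, mul_add, Polynomial.add_modByMonic]

theorem gfMul_smul {n : ℕ} (p : (ZMod 2)[X]) (z : ZMod 2) (v w : Bits n) :
    gfMul p v (z • w) = z • gfMul p v w := by
  funext i
  simp [gfMul, toPoly_smul, Polynomial.smul_modByMonic]

theorem gfMul_eq_zero {n : ℕ} {p : (ZMod 2)[X]} (hp : Irreducible p) (hdeg : p.natDegree = n)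
    {v w : Bits n} (h : gfMul p v w = 0) : v = 0 ∨ w = 0 := by
  -- `%ₘ` is division by a monic polynomial; over `GF(2)` every nonzero polynomial is monic
  have hmonic : p.Monic := by
    have h0 : p.leadingCoeff ≠ 0 := Polynomial.leadingCoeff_ne_zero.2 hp.ne_zero
    have h1 : ∀ x : ZMod 2, x ≠ 0 → x = 1 := by decide
    exact h1 _ h0
  have hpdeg : p.degree = n := by rw [Polynomial.degree_eq_natDegree hp.ne_zero, hdeg]
  have hmod : (toPoly v * toPoly w) %ₘ p = 0 := by
    ext m
    by_cases hm : m < n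
    · exact congrFun h ⟨m, hm⟩
    · rw [Polynomial.coeff_zero]
      refine Polynomial.coeff_eq_zero_of_degree_lt ?_
      refine (Polynomial.degree_modByMonic_lt _ hmonic).trans_le ?_
      rw [hpdeg]
      exact_mod_cast not_lt.1 hm
  have hdvd := (Polynomial.modByMonic_eq_zero_iff_dvd hmonic).1 hmod
  have hz : ∀ u : Bits n, p ∣ toPoly u → u = 0 := fun u hu =>
    toPoly_injective <| by
      rw [Polynomial.eq_zero_of_dvd_of_degree_lt hu (hpdeg ▸ degree_toPoly_lt u)]
      simp [toPoly]
  exact (hp.prime.dvd_or_dvd hdvd).imp (hz v) (hz w)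

/-- The hash `r ↦ (k · r) mod 2 ^ ℓ` as a linear map in the seed `r`. -/
noncomputable def hashLinear {n : ℕ} (ℓ : ℕ) (h : ℓ ≤ n) (p : (ZMod 2)[X]) (k : Bits n) :
    Bits n →ₗ[ZMod 2] Bits ℓ where
  toFun r := lowBits ℓ h (gfMul p k r)
  map_add' r r' := by rw [gfMul_add]; rfl
  map_smul' z r := by rw [gfMul_smul]; rfl

theorem hashLinear_surjective {n ℓ : ℕ} (h : ℓ ≤ n) {p : (ZMod 2)[X]} (hp : Irreducible p)
    (hdeg : p.natDegree = n) {k : Bits n} (hk : k ≠ 0) :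
    Function.Surjective (hashLinear ℓ h p k) := by
  -- for `ℓ = n` the hash is multiplication by `k` in the field
  have hinj : Function.Injective (hashLinear n le_rfl p k) := by
    refine (injective_iff_map_eq_zero _).2 fun r hr => ?_
    exact (gfMul_eq_zero hp hdeg (v := k) (w := r) hr).resolve_left hk
  have hsurj := LinearMap.injective_iff_surjective.1 hinj
  intro y
  obtain ⟨r, hr⟩ := hsurj fun i => if hi : (i : ℕ) < ℓ then y ⟨i, hi⟩ else 0
  refine ⟨r, funext fun i => ?_⟩
  have := congrFun hr (Fin.castLE h i)
  simpa [hashLinear, lowBits] using this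

/-- The hash family is universal: two distinct keys collide for exactly a fraction `2 ^ -ℓ` of the
seeds. -/
theorem card_collision {n ℓ : ℕ} (h : ℓ ≤ n) {p : (ZMod 2)[X]} (hp : Irreducible p)
    (hdeg : p.natDegree = n) {k k' : Bits n} (hk : k ≠ k') :
    (Finset.univ.filter fun r : Bits n =>
      lowBits ℓ h (gfMul p k r) = lowBits ℓ h (gfMul p k' r)).card * Fintype.card (Bits ℓ) =
      Fintype.card (Bits n) := by
  set f := hashLinear ℓ h p (k - k')
  have hsurj : Function.Surjective f := hashLinear_surjective h hp hdeg (sub_ne_zero.2 hk)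
  have e1 : ∀ r : Bits n, lowBits ℓ h (gfMul p k r) = lowBits ℓ h (gfMul p k' r) ↔
      r ∈ LinearMap.ker f := by
    intro r
    have : gfMul p k r = gfMul p (k - k') r + gfMul p k' r := by
      rw [gfMul_comm p k, gfMul_comm p (k - k'), gfMul_comm p k', ← gfMul_add, sub_add_cancel]
    rw [LinearMap.mem_ker, this]
    change f r + lowBits ℓ h (gfMul p k' r) = lowBits ℓ h (gfMul p k' r) ↔ _
    exact add_eq_right
  have e2 : (Finset.univ.filter fun r : Bits n =>
      lowBits ℓ h (gfMul p k r) = lowBits ℓ h (gfMul p k' r)).card =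
      Nat.card (LinearMap.ker f) := by
    classical
    rw [Nat.card_eq_fintype_card, Fintype.card_subtype]
    exact congrArg Finset.card (Finset.filter_congr fun r _ => e1 r)
  have e3 := Submodule.card_eq_card_quotient_mul_card (LinearMap.ker f)
  rw [Nat.card_congr (f.quotKerEquivOfSurjective hsurj).toEquiv] at e3
  rw [e2, ← Nat.card_eq_fintype_card, ← Nat.card_eq_fintype_card, e3]

/-- The deviation of the law of the ciphertext `c = a + h_r k`, for given `k` and `r`, from the
uniform law. -/
noncomputable def hashWeight {n : ℕ} (ℓ : ℕ) (h : ℓ ≤ n) (p : (ZMod 2)[X]) (a : Bits ℓ)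
    (j : Bits ℓ × Bits n) (k : Bits n) : ℝ :=
  ((Fintype.card (Bits ℓ) : ℕ) : ℝ)⁻¹ -
    (if a + lowBits ℓ h (gfMul p k j.2) = j.1 then 1 else 0 : ℝ)

/-- The hash weights of distinct keys are orthogonal, because the hash family is universal. -/
theorem hashWeight_gram {n ℓ : ℕ} (h : ℓ ≤ n) {p : (ZMod 2)[X]} (hp : Irreducible p)
    (hdeg : p.natDegree = n) (a : Bits ℓ) (k k' : Bits n) :
    ∑ j, hashWeight ℓ h p a j k * hashWeight ℓ h p a j k' =
      if k = k' then (Fintype.card (Bits n) : ℝ) * (1 - (Fintype.card (Bits ℓ) : ℝ)⁻¹)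
      else 0 := by
  set L : ℝ := (Fintype.card (Bits ℓ) : ℝ) with hL
  have hL0 : L ≠ 0 := by simp [hL]
  have inner : ∀ x y : Bits ℓ, ∑ c : Bits ℓ, (L⁻¹ - if a + x = c then 1 else 0) *
      (L⁻¹ - if a + y = c then 1 else 0) = (if x = y then 1 else 0) - L⁻¹ := by
    intro x y
    have e : ∀ c : Bits ℓ, (L⁻¹ - if a + x = c then 1 else 0) *
        (L⁻¹ - if a + y = c then 1 else 0) = L⁻¹ * L⁻¹ - (if a + x = c then L⁻¹ else 0) -
          (if a + y = c then L⁻¹ else 0) +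
            (if a + x = c then (if a + y = c then 1 else 0) else 0) := by
      intro c
      split_ifs <;> ring
    simp only [e, Finset.sum_add_distrib, Finset.sum_sub_distrib, Finset.sum_ite_eq,
      Finset.mem_univ, if_true, Finset.sum_const, Finset.card_univ, nsmul_eq_mul]
    rw [← hL]
    have e2 : (a + y = a + x) ↔ x = y := by rw [add_right_inj, eq_comm]
    simp only [e2]
    field_simp
    ring
  have hsum : ∑ j, hashWeight ℓ h p a j k * hashWeight ℓ h p a j k' =
      ((Finset.univ.filter fun r : Bits n =>
        lowBits ℓ h (gfMul p k r) = lowBits ℓ h (gfMul p k' r)).card : ℝ) -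
        Fintype.card (Bits n) * L⁻¹ := by
    rw [Fintype.sum_prod_type_right]
    simp only [hashWeight, ← hL, inner, Finset.sum_sub_distrib, Finset.sum_const,
      Finset.card_univ, nsmul_eq_mul, Finset.sum_boole]
  rw [hsum]
  split_ifs with hk
  · subst hk
    simp only [Finset.filter_true, Finset.card_univ]
    ring
  · have := card_collision h hp hdeg hk
    rw [← this]
    push_cast
    rw [← hL, mul_assoc, mul_inv_cancel₀ hL0]
    ring

/-! ### The protocol and the simulator as channels -/

theorem tensorMap_id_conjMap {α β γ : Type*} [Fintype α] [Fintype γ] [DecidableEq γ]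
    (L : Matrix β α ℂ) (X : Op (γ × α)) :
    tensorMap (LinearMap.id : Op γ →ₗ[ℂ] Op γ) (conjMap L) X =
      ((1 : Op γ) ⊗ₖ L) * X * ((1 : Op γ) ⊗ₖ L)ᴴ := by
  ext ⟨g, x⟩ ⟨g', y⟩
  simp [tensorMap, conjMap, Matrix.mul_apply, Fintype.sum_prod_type, Matrix.one_apply, ite_mul,
    Finset.sum_ite_irrel, apply_ite (starRingEnd ℂ)]

/-- A uniform mixture of Kraus maps is a channel if the Kraus operators satisfy the completeness
relation. -/
theorem isChannel_kraus {α β J : Type*} [Fintype α] [DecidableEq α] [Fintype β] [Fintype J]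
    {s : ℝ} (hs : 0 ≤ s) (L : J → Matrix β α ℂ) (hL : (s : ℂ) • ∑ j, (L j)ᴴ * L j = 1) :
    IsChannel ((s : ℂ) • ∑ j, conjMap (L j)) where
  trace_map X := by
    have h : ∀ j, (conjMap (L j) X).trace = ((L j)ᴴ * L j * X).trace := fun j => by
      change (L j * X * (L j)ᴴ).trace = _
      rw [Matrix.trace_mul_cycle]
    rw [LinearMap.smul_apply, LinearMap.sum_apply, Matrix.trace_smul, Matrix.trace_sum]
    simp only [h]
    rw [← Matrix.trace_sum, ← Matrix.sum_mul, ← Matrix.trace_smul, ← Matrix.smul_mul, hL,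
      Matrix.one_mul]
  completelyPositive m X hX := by
    have h : tensorMap (LinearMap.id : Op (Fin m) →ₗ[ℂ] Op (Fin m))
        ((s : ℂ) • ∑ j, conjMap (L j)) X =
        s • ∑ j, tensorMap (LinearMap.id : Op (Fin m) →ₗ[ℂ] Op (Fin m)) (conjMap (L j)) X := by
      ext p q
      simp [tensorMap, LinearMap.sum_apply, Matrix.sum_apply]
    rw [h]
    refine Matrix.PosSemidef.smul (Matrix.posSemidef_sum _ fun j _ => ?_) hs
    rw [tensorMap_id_conjMap]
    exact hX.mul_mul_conjTranspose_same _

theorem conjMap_single_apply {α β : Type*} [Fintype α] [DecidableEq α] [DecidableEq β]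
    (x : β) (i : α) (X : Op α) (p q : β) :
    conjMap (Matrix.single x i (1 : ℂ)) X p q = if x = p ∧ x = q then X i i else 0 := by
  simp only [conjMap, LinearMap.coe_mk, AddHom.coe_mk, Matrix.conjTranspose_single, star_one,
    Matrix.single_mul_mul_single, one_mul, mul_one, Matrix.single_apply]

theorem evalChannel_apply {α β : Type*} [Fintype α] [DecidableEq α] [DecidableEq β] (f : α → β)
    (X : Op α) (p q : β) :
    evalChannel f X p q = if p = q then ∑ i, if f i = p then X i i else 0 else 0 := by
  simp only [evalChannel, LinearMap.sum_apply, Matrix.sum_apply, conjMap_single_apply]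
  split_ifs with h
  · subst h
    simp only [and_self]
  · exact Finset.sum_eq_zero fun i _ => if_neg fun hi => h (hi.1.symm.trans hi.2)

theorem isChannel_protocol {n : ℕ} (ℓ : ℕ) (h : ℓ ≤ n) (p : (ZMod 2)[X]) :
    IsChannel (protocol ℓ h p) := by
  have e : protocol ℓ h p = (((Fintype.card (Bits n) : ℝ)⁻¹ : ℝ) : ℂ) •
      ∑ j : Bits n × (Bits n × Bits ℓ × Bits ℓ × (Bits ℓ × Bits n)),
        conjMap (Matrix.single (protocolRun ℓ h p j.1 j.2) j.2 (1 : ℂ)) := by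
    rw [Fintype.sum_prod_type, protocol]
    simp only [evalChannel]
    push_cast
    rfl
  rw [e]
  refine isChannel_kraus (by positivity) _ ?_
  simp only [Matrix.conjTranspose_single, star_one, Matrix.single_mul_single_same, one_mul]
  rw [Fintype.sum_prod_type]
  simp only [Finset.sum_const, Finset.card_univ]
  have h1 : ∑ i : Bits n × Bits ℓ × Bits ℓ × (Bits ℓ × Bits n), Matrix.single i i (1 : ℂ) = 1 :=
    Matrix.sum_single_one
  rw [h1, ← Nat.cast_smul_eq_nsmul ℂ, smul_smul]
  simp

/-- The simulator: it replaces the register `C` by a uniformly random value and leaves `E`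
untouched, `X ↦ |C|⁻¹ ∑ c c₀, (|c⟩⟨c₀| ⊗ 1) X (|c₀⟩⟨c| ⊗ 1)`. -/
noncomputable def refreshChannel (C E : Type*) [Fintype C] [DecidableEq C] [Fintype E]
    [DecidableEq E] : Op (C × E) →ₗ[ℂ] Op (C × E) :=
  (((Fintype.card C : ℝ)⁻¹ : ℝ) : ℂ) •
    ∑ j : C × C, conjMap (Matrix.single j.1 j.2 (1 : ℂ) ⊗ₖ (1 : Op E))

theorem isChannel_refreshChannel (C E : Type*) [Fintype C] [DecidableEq C] [Nonempty C]
    [Fintype E] [DecidableEq E] : IsChannel (refreshChannel C E) := by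
  refine isChannel_kraus (by positivity) _ ?_
  simp only [Matrix.conjTranspose_kronecker, ← Matrix.mul_kronecker_mul, Matrix.conjTranspose_one,
    Matrix.conjTranspose_single, star_one, Matrix.single_mul_single_same, one_mul]
  rw [Fintype.sum_prod_type]
  have h1 : ∑ i : C, Matrix.single i i (1 : ℂ) = 1 := Matrix.sum_single_one
  have h2 : ∑ i : C, Matrix.single i i (1 : ℂ) ⊗ₖ (1 : Op E) = 1 := by
    rw [← Matrix.one_kronecker_one, ← h1]
    ext p q
    simp only [Matrix.sum_apply, Matrix.kroneckerMap_apply, Finset.sum_mul]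
  simp only [h2, Finset.sum_const, Finset.card_univ]
  rw [ ← Nat.cast_smul_eq_nsmul ℂ, smul_smul]
  simp

theorem refreshChannel_apply {C E : Type*} [Fintype C] [DecidableEq C] [Fintype E]
    [DecidableEq E] (X : Op (C × E)) (c c' : C) (e e' : E) :
    refreshChannel C E X (c, e) (c', e') =
      if c = c' then (Fintype.card C : ℂ)⁻¹ * ∑ c₀, X (c₀, e) (c₀, e') else 0 := by
  have h : ∀ x i : C, conjMap (Matrix.single x i (1 : ℂ) ⊗ₖ (1 : Op E)) X (c, e) (c', e') =
      if x = c then (if x = c' then X (i, e) (i, e') else 0) else 0 := by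
    intro x i
    simp [conjMap, Matrix.mul_apply, Fintype.sum_prod_type, Matrix.one_apply, Matrix.single_apply,
      ite_and, ite_mul, Finset.sum_ite_irrel, apply_ite (starRingEnd ℂ)]
    split_ifs <;> rfl
  simp only [refreshChannel, LinearMap.smul_apply, LinearMap.sum_apply, Matrix.smul_apply,
    Matrix.sum_apply, h, Fintype.sum_prod_type_right, Finset.sum_ite_eq', Finset.mem_univ,
    if_true]
  split_ifs <;> simp

theorem idealPrivateChannel_apply {A : Type*} [Fintype A] [DecidableEq A] (X : Op (A × A))
    (a b a' b' : A) :
    idealPrivateChannel A X (a, b) (a', b') =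
      if b = a ∧ a' = a ∧ b' = a then ∑ y, X (a, y) (a, y) else 0 := by
  have h : ∀ x y : A,
      conjMap (Matrix.single x x (1 : ℂ) ⊗ₖ Matrix.single x y (1 : ℂ)) X (a, b) (a', b') =
        if x = a then (if b = a ∧ a' = a ∧ b' = a then X (a, y) (a, y) else 0) else 0 := by
    intro x y
    rw [Matrix.single_kronecker_single, mul_one, conjMap_single_apply]
    simp only [Prod.mk.injEq]
    by_cases hx : x = a
    · subst hx
      simp only [true_and, if_true]
      congr 1
      simp only [eq_comm]
    · simp [hx]
  simp only [idealPrivateChannel, LinearMap.sum_apply, Matrix.sum_apply, h]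
  rw [Finset.sum_comm]
  simp only [Finset.sum_ite_eq', Finset.mem_univ, if_true]
  split_ifs <;> simp

/-- The unnormalised state of the registers `D` and `E` given key `k` and message `a`: the
block of `ρ` at `k` and `a`, with `B` and `C` traced out. -/
def condState {K A C D E : Type*} [Fintype A] [Fintype C] (ρ : Op (K × A × A × C × D × E))
    (k : K) (a : A) : Op (D × E) :=
  ∑ b, ∑ c, ρ.submatrix (fun s => (k, a, b, c, s)) (fun s => (k, a, b, c, s))

theorem idealOutput_apply {K A C D E : Type*} [Fintype K] [Fintype A] [DecidableEq A] [Fintype C]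
    [DecidableEq C] [Fintype E] [DecidableEq E] (ρ : Op (K × A × A × C × D × E))
    (a b a' b' : A) (c c' : C) (s t : D × E) :
    idealOutput (refreshChannel C E) (traceFst ρ) (a, b, c, s) (a', b', c', t) =
      if (b = a ∧ a' = a ∧ b' = a) ∧ c' = c then
        (Fintype.card C : ℂ)⁻¹ * ∑ k, condState ρ k a s t else 0 := by
  obtain ⟨d, e⟩ := s
  obtain ⟨d', e'⟩ := t
  simp only [idealOutput, tensorMap, LinearMap.coe_mk, AddHom.coe_mk, Matrix.submatrix_apply,
    Matrix.of_apply, refreshChannel_apply, idealPrivateChannel_apply, LinearMap.id_apply,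
    traceFst, condState, Matrix.sum_apply]
  by_cases h1 : b = a ∧ a' = a ∧ b' = a
  · by_cases h2 : c' = c
    · subst h2
      simp only [h1, and_self, if_true]
      congr 1
      rw [Finset.sum_comm]
      simp only [Finset.sum_comm (s := (Finset.univ : Finset K))]
    · simp only [h2, Ne.symm h2, if_false, and_false]
  · simp only [h1, if_false, false_and, Finset.sum_const_zero, mul_zero, ite_self]

/-- Averaging over `r`, weighted by `2⁻ⁿ`, leaves only the seed that is recorded in `C`. -/
theorem realOutput_apply {D E : Type*} {n : ℕ} (ℓ : ℕ) (h : ℓ ≤ n) (p : (ZMod 2)[X])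
    (ρ : Op (Bits n × Bits ℓ × Bits ℓ × (Bits ℓ × Bits n) × D × E))
    (a b a' b' : Bits ℓ) (j j' : Bits ℓ × Bits n) (s t : D × E) :
    realOutput (protocol ℓ h p) ρ (a, b, j, s) (a', b', j', t) =
      if (b = a ∧ a' = a ∧ b' = a) ∧ j' = j then
        (Fintype.card (Bits n) : ℂ)⁻¹ *
          ∑ k, (if a + lowBits ℓ h (gfMul p k j.2) = j.1 then 1 else 0) * condState ρ k a s t
      else 0 := by
  obtain ⟨d, e⟩ := s
  obtain ⟨d', e'⟩ := t
  obtain ⟨c, r⟩ := j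
  have hrun : ∀ (r' : Bits n) (k : Bits n) (a₀ b₀ : Bits ℓ) (c₀ : Bits ℓ × Bits n),
      protocolRun ℓ h p r' (k, a₀, b₀, c₀) = (a, b, (c, r)) ↔
        r' = r ∧ a₀ = a ∧ b = a ∧ a + lowBits ℓ h (gfMul p k r) = c := by
    intro r' k a₀ b₀ c₀
    -- Bob recovers the message, since the mask cancels in characteristic two
    have hchar : ∀ v w : Bits ℓ, v + w + w = v := fun v w => by
      funext i
      simp only [Pi.add_apply, add_assoc, CharTwo.add_self_eq_zero, add_zero]
    simp only [protocolRun, hchar, Prod.mk.injEq]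
    constructor
    · rintro ⟨rfl, rfl, hc, rfl⟩
      exact ⟨rfl, rfl, rfl, hc⟩
    · rintro ⟨rfl, rfl, rfl, hc⟩
      exact ⟨rfl, rfl, hc, rfl⟩
  simp only [realOutput, tensorMap, protocol, LinearMap.coe_mk, AddHom.coe_mk,
    Matrix.submatrix_apply, Matrix.of_apply, LinearMap.id_apply, LinearMap.smul_apply,
    LinearMap.sum_apply, Matrix.smul_apply, Matrix.sum_apply, evalChannel_apply, smul_eq_mul,
    condState]
  by_cases hpq : (a, b, (c, r)) = (a', b', j')
  · have hpq' := hpq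
    simp only [Prod.mk.injEq] at hpq'
    obtain ⟨rfl, rfl, rfl⟩ := hpq'
    by_cases hb : b = a
    · subst hb
      simp only [if_true, and_self, hrun, true_and]
      congr 1
      rw [Finset.sum_eq_single r (fun r' _ hr => by simp [hr]) (by simp)]
      simp only [true_and]
      rw [Fintype.sum_prod_type]
      refine Finset.sum_congr rfl fun k _ => ?_
      rw [Fintype.sum_prod_type, Finset.sum_eq_single b (fun a₀ _ ha => by simp [ha]) (by simp)]
      simp only [true_and, ite_mul, one_mul, zero_mul]
      rw [Fintype.sum_prod_type]
      split_ifs <;> simp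
    · simp only [hb, if_true, false_and, if_false, hrun,
        and_false, Finset.sum_const_zero, mul_zero]
  · simp only [hpq, if_false, Finset.sum_const_zero, mul_zero]
    rw [if_neg]
    rintro ⟨⟨rfl, rfl, rfl⟩, rfl⟩
    exact hpq rfl

/-! ### Admissible inputs and the security bound -/

section Admissible

variable {K A C D E : Type*} [Fintype A] [Fintype C] {ρ : Op (K × A × A × C × D × E)}

theorem condState_posSemidef (hρ : ρ.PosSemidef) (k : K) (a : A) :
    (condState ρ k a).PosSemidef :=
  Matrix.posSemidef_sum _ fun _ _ => Matrix.posSemidef_sum _ fun _ _ => hρ.submatrix _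

theorem sum_trace_condState [Fintype K] [Fintype D] [Fintype E] :
    ∑ k, ∑ a, (condState ρ k a).trace = ρ.trace := by
  simp only [condState, Matrix.trace_sum]
  simp only [Matrix.trace, Matrix.diag_apply, Matrix.submatrix_apply]
  rw [Fintype.sum_prod_type]
  refine Finset.sum_congr rfl fun k _ => ?_
  rw [Fintype.sum_prod_type]
  refine Finset.sum_congr rfl fun a _ => ?_
  rw [Fintype.sum_prod_type]
  refine Finset.sum_congr rfl fun b _ => ?_
  rw [Fintype.sum_prod_type]

variable [Fintype K] [DecidableEq K] [Fintype D] [Fintype E]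

/-- The key is uniform and independent of `D` and `E` once the message is averaged out. -/
theorem IsAdmissible.sum_condState (hρ : IsAdmissible ρ) (k : K) :
    ∑ a, condState ρ k a = ((Fintype.card K : ℝ)⁻¹ : ℝ) • ∑ k', ∑ a, condState ρ k' a := by
  ext s t
  have hkey : ∀ b c, ∑ a, ρ (k, a, b, c, s) (k, a, b, c, t) =
      (Fintype.card K : ℂ)⁻¹ * ∑ a, ∑ k', ρ (k', a, b, c, s) (k', a, b, c, t) := by
    intro b c
    have h := congrFun (congrFun hρ.key (k, b, c, s)) (k, b, c, t)
    simpa [traceFst, maximallyMixed, Matrix.kroneckerMap_apply] using h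
  simp only [condState, Matrix.sum_apply, Matrix.smul_apply, Matrix.submatrix_apply,
    Complex.real_smul, Complex.ofReal_inv, Complex.ofReal_natCast]
  have hswap : ∀ k', ∑ a, ∑ b, ∑ c, ρ (k', a, b, c, s) (k', a, b, c, t) =
      ∑ b, ∑ c, ∑ a, ρ (k', a, b, c, s) (k', a, b, c, t) := fun k' => by
    rw [Finset.sum_comm]
    exact Finset.sum_congr rfl fun b _ => Finset.sum_comm
  simp only [hswap, hkey]
  simp only [← Finset.mul_sum]
  congr 1
  symm
  rw [Finset.sum_comm]
  refine Finset.sum_congr rfl fun b _ => ?_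
  rw [Finset.sum_comm]
  refine Finset.sum_congr rfl fun c _ => ?_
  rw [Finset.sum_comm]

/-- Whatever the correlation of the message with the key, the state for fixed `k` and `a` is
dominated by the state of `D E` weighted by the probability of `k`. -/
theorem IsAdmissible.condState_le (hρ : IsAdmissible ρ) (k : K) (a : A) :
    (((Fintype.card K : ℝ)⁻¹ : ℝ) • (∑ k', ∑ a', condState ρ k' a') -
      condState ρ k a).PosSemidef := by
  classical
  rw [← hρ.sum_condState k, ← Finset.sum_erase_eq_sub (Finset.mem_univ a)]
  exact Matrix.posSemidef_sum _ fun a' _ => condState_posSemidef hρ.isState.posSemidef k a'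

end Admissible

/-- The trace of `U Δ` when `Δ` is block diagonal in `A B C` with both copies of the message
equal. -/
theorem trace_mul_eq_sum_blocks {A C F : Type*} [Fintype A] [DecidableEq A] [Fintype C]
    [DecidableEq C] [Fintype F] {U Δ : Op (A × A × C × F)} {M : A → C → Op F}
    (hΔ : ∀ a b a' b' c c' s t, Δ (a, b, c, s) (a', b', c', t) =
      if (b = a ∧ a' = a ∧ b' = a) ∧ c' = c then M a c s t else 0) :
    (U * Δ).trace =
      ∑ a, ∑ c, (U.submatrix (fun s => (a, a, c, s)) (fun s => (a, a, c, s)) * M a c).trace := by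
  rw [Matrix.trace_mul_comm]
  simp only [Matrix.trace_mul_comm _ (M _ _)]
  simp only [Matrix.trace, Matrix.diag_apply, Matrix.mul_apply, Fintype.sum_prod_type, hΔ,
    ite_and, ite_mul, zero_mul, Finset.sum_ite_irrel, Finset.sum_const_zero, Finset.sum_ite_eq',
    Finset.mem_univ, if_true, Matrix.submatrix_apply]

theorem traceNorm_ideal_sub_real_le {D E : Type*} [Fintype D] [DecidableEq D] [Fintype E]
    [DecidableEq E] {ℓ n : ℕ} (h : ℓ ≤ n) {p : (ZMod 2)[X]} (hp : Irreducible p)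
    (hdeg : p.natDegree = n)
    {ρ : Op (Bits n × Bits ℓ × Bits ℓ × (Bits ℓ × Bits n) × D × E)} (hρ : IsAdmissible ρ) :
    traceNorm (idealOutput (refreshChannel (Bits ℓ × Bits n) E) (traceFst ρ) -
      realOutput (protocol ℓ h p) ρ) ≤ √((2 : ℝ) ^ (2 * (ℓ : ℤ) - (n : ℤ))) := by
  set N : ℝ := (Fintype.card (Bits n) : ℝ) with hN
  set L : ℝ := (Fintype.card (Bits ℓ) : ℝ) with hL
  have hN2 : N = 2 ^ n := by simp [hN]
  have hL2 : L = 2 ^ ℓ := by simp [hL]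
  have hN0 : 0 < N := by rw [hN2]; positivity
  have hL0 : 0 < L := by rw [hL2]; positivity
  obtain ⟨U, hU, hUtr⟩ := exists_contraction_trace_mul
    (idealOutput (refreshChannel (Bits ℓ × Bits n) E) (traceFst ρ) - realOutput (protocol ℓ h p) ρ)
  rw [trace_mul_eq_sum_blocks (M := fun a j =>
    ∑ k, ((N⁻¹ * hashWeight ℓ h p a j k : ℝ) : ℂ) • condState ρ k a)] at hUtr
  · rw [← Complex.ofReal_re (traceNorm _), hUtr]
    have htr := sum_trace_condState (ρ := ρ)
    rw [hρ.isState.trace_eq_one] at htr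
    refine sum_trace_mul_hash_le (σ := ∑ k, ∑ a, condState ρ k a)
      (c := N * (1 - L⁻¹)) hN0 ?_ (hashWeight_gram h hp hdeg) ?_ ?_
      (fun k a => condState_posSemidef hρ.isState.posSemidef k a) ?_ hρ.condState_le
      (fun a j => contraction_submatrix hU fun s t hst => by simpa using hst)
      (Real.sqrt_pos.2 (by positivity)) ?_
    · have := inv_nonneg.2 hL0.le
      nlinarith
    · exact Matrix.posSemidef_sum _ fun k _ => Matrix.posSemidef_sum _ fun a _ =>
        condState_posSemidef hρ.isState.posSemidef k a
    · simp only [Matrix.trace_sum, htr, Complex.one_re]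
    · simp only [← Complex.re_sum, htr, Complex.one_re]
    · rw [Real.sq_sqrt (by positivity), Fintype.card_prod, Nat.cast_mul, ← hL, ← hN, hL2, hN2,
        zpow_sub₀ two_ne_zero, zpow_mul, zpow_natCast, zpow_natCast]
      refine le_of_eq ?_
      field_simp
      norm_cast
      rw [← pow_mul, ← pow_mul, mul_comm]
  · intro a b a' b' j j' s t
    rw [Matrix.sub_apply, idealOutput_apply, realOutput_apply]
    split_ifs
    · rw [Fintype.card_prod, Nat.cast_mul, mul_inv, Finset.mul_sum, Finset.mul_sum,
        ← Finset.sum_sub_distrib, Matrix.sum_apply]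
      refine Finset.sum_congr rfl fun k _ => ?_
      simp only [Matrix.smul_apply, smul_eq_mul, hashWeight, hN]
      split_ifs <;> push_cast <;> ring
    · exact sub_zero 0

end InsiderProof

theorem theorem1 (ℓ n : ℕ) (hn : 2 * ℓ < n) (p : (ZMod 2)[X]) (hp : Irreducible p)
    (hdeg : p.natDegree = n) :
    InsiderProof.IsInsiderProofPrivateChannel
      (InsiderProof.protocol ℓ (show ℓ ≤ n by omega) p)
      (√((2 : ℝ) ^ (2 * (ℓ : ℤ) - (n : ℤ)))) :=
  ⟨InsiderProof.isChannel_protocol ℓ _ p, fun E _ _ =>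
    ⟨InsiderProof.refreshChannel _ E, InsiderProof.isChannel_refreshChannel _ E,
      fun _ _ _ _ hρ => InsiderProof.traceNorm_ideal_sub_real_le _ hp hdeg hρ⟩⟩
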